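/- There is an absolute constant $c>0$ such that the following holds. Let $p$ be a prime, let $a,b\in\mathbb F_p$ with $a\neq 0$, and let $\mathcal S=(s_n)_{n\ge 0}$ be the explicit inversive generator over $\mathbb F_p$, that is, $s_n=(an-b)^{-1}$ if $an-b\neq 0$ in $\mathbb F_p$, and $s_n=0$ otherwise. Let $G(x)=\sum_{n\ge 0}s_nx^n\in\mathbb F_p[[x]]$ be its generating function, and for $N\ge 1$ let the $N$th expansion complexity $E_N(\mathcal S)$ be $0$ if $s_0=\dots=s_{N-1}=0$, and otherwise the least total degree of a nonzero polynomial $h(x,y)\in\mathbb F_p[x,y]$ with $h(x,G(x))\equiv 0 \pmod{x^N}$. Then $$E_N(\mathcal S)\ \ge\ c\,N^{1/4}\qquad\text{for all integers } N \text{ with } 2\le N<p.$$ -/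

import Mathlib

noncomputable section

/-- The generating function `G(x) = ∑ sₙ xⁿ` of a sequence, as a formal power series. -/
def genFun {F : Type*} [Field F] (s : ℕ → F) : PowerSeries F :=
  PowerSeries.mk s

/-- `h(x, G(x)) ≡ 0 mod x^N`, where the variable `0` of `h` is `x` and the variable `1` is `y`. -/
def AnnihilatesMod {F : Type*} [Field F] (s : ℕ → F) (N : ℕ)
    (h : MvPolynomial (Fin 2) F) : Prop :=
  (PowerSeries.X : PowerSeries F) ^ N ∣ MvPolynomial.aeval ![PowerSeries.X, genFun s] h

open scoped Classical in
/-- The `N`th expansion complexity `E_N` of a sequence: `0` if the first `N` terms vanish, and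
otherwise the least total degree of a nonzero polynomial `h(x, y)` with
`h(x, G(x)) ≡ 0 mod x^N`. -/
def expansionComplexity {F : Type*} [Field F] (s : ℕ → F) (N : ℕ) : ℕ :=
  if ∀ n < N, s n = 0 then 0
  else sInf {d : ℕ | ∃ h : MvPolynomial (Fin 2) F,
    h ≠ 0 ∧ AnnihilatesMod s N h ∧ h.totalDegree = d}

/-- The set whose least element defines the expansion complexity is never empty
(it contains the total degree of `x^N`), so the infimum is attained. -/
theorem expansionComplexity_set_nonempty {F : Type*} [Field F] (s : ℕ → F) (N : ℕ) :
    {d : ℕ | ∃ h : MvPolynomial (Fin 2) F,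
      h ≠ 0 ∧ AnnihilatesMod s N h ∧ h.totalDegree = d}.Nonempty :=
  ⟨_, MvPolynomial.X 0 ^ N, pow_ne_zero _ (MvPolynomial.X_ne_zero 0),
    by simp [AnnihilatesMod], rfl⟩

/-- The explicit inversive generator over `F_p` with parameters `a` and `b`. -/
def explicitInversive (p : ℕ) [Fact p.Prime] (a b : ZMod p) (n : ℕ) : ZMod p :=
  if a * (n : ZMod p) - b = 0 then 0 else (a * (n : ZMod p) - b)⁻¹

end

open Polynomial

/-! Since `(a n - b) s_n = 1` except at one residue `n₀`, the series `G` solves `a x(1-x) G' =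
b(1-x) G + γ` to high order, with `γ` a polynomial and `γ(1) ≠ 0`. Let an irreducible `f` vanish
along `G` to order `T`. The vector field of the equation turns `f` into a `g` that also vanishes to
order `T`, so `x^T` divides their resultant in `y`. If that is nonzero, its degree bounds `T`. If it
is zero, `f` divides `g` over `F(x)`, and the top two coefficients of `f` give a rational solution
of such an equation, excluded by `rational_ode_unsolvable`. Additivity of order and degree extends
the bound to all `h`. The degree of `γ` enters the bound. Taking `γ = 1` below `n₀` shows that `n₀`
is small or `N ≤ n₀`; if `n₀` is small, the full equation has `γ` of degree at most `n₀ + 1`. This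
yields `N = O(d³)`, more than is needed. -/

/-- For `y = A/B` the equation reads `a x(1-x) y' = b(1-x) y - e γ`. Setting `x = 1` forces a pole
there; a pole of order `m` survives on the left with factor `m`, nonzero because `m < p`, but drops
in order on the right. -/
theorem rational_ode_unsolvable {F : Type*} [Field F] (p : ℕ) [CharP F p]
    {a b e : F} (ha : a ≠ 0) (he : e ≠ 0) {γ A B : F[X]} (hγ : γ.eval 1 ≠ 0) (hB : B ≠ 0)
    (hBp : B.natDegree < p)
    (h : C a * X * (1 - X) * (derivative A * B - A * derivative B) =
      C b * (1 - X) * A * B - C e * γ * B ^ 2) : False := by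
  classical
  obtain ⟨A₁, hA₁⟩ := EuclideanDomain.gcd_dvd_left A B
  obtain ⟨B₁, hB₁⟩ := EuclideanDomain.gcd_dvd_right A B
  set g := EuclideanDomain.gcd A B with hg
  have hg0 : g ≠ 0 := by rintro h0; apply hB; rw [hB₁, h0, zero_mul]
  have hB₁0 : B₁ ≠ 0 := by rintro h0; apply hB; rw [hB₁, h0, mul_zero]
  have hco : IsCoprime A₁ B₁ := by
    obtain ⟨u, v, huv⟩ : ∃ u v, g = A * u + B * v :=
      ⟨_, _, EuclideanDomain.gcd_eq_gcd_ab A B⟩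
    refine ⟨u, v, mul_left_cancel₀ hg0 ?_⟩
    calc g * (u * A₁ + v * B₁) = (g * A₁) * u + (g * B₁) * v := by ring
      _ = g * 1 := by rw [← hA₁, ← hB₁, ← huv, mul_one]
  have h₁ : C a * X * (1 - X) * (derivative A₁ * B₁ - A₁ * derivative B₁) =
      C b * (1 - X) * A₁ * B₁ - C e * γ * B₁ ^ 2 := by
    apply mul_left_cancel₀ (pow_ne_zero 2 hg0)
    rw [hA₁, hB₁] at h
    simp only [derivative_mul] at h
    linear_combination h
  have hroot : B₁.eval 1 = 0 := by
    have := congrArg (eval 1) h₁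
    simpa [he, hγ] using this
  have hA1 : A₁.eval 1 ≠ 0 := by
    intro h0
    obtain ⟨u, v, huv⟩ := hco
    have := congrArg (eval 1) huv
    simp [h0, hroot] at this
  obtain ⟨D, hD, hDnd⟩ := exists_eq_pow_rootMultiplicity_mul_and_not_dvd B₁ hB₁0 1
  set m := B₁.rootMultiplicity 1 with hm
  have hmpos : 0 < m := (rootMultiplicity_pos hB₁0).2 hroot
  have hD1 : D.eval 1 ≠ 0 := fun h0 => hDnd (dvd_iff_isRoot.2 h0)
  have hmB : m ≤ B₁.natDegree := by
    have := natDegree_le_of_dvd (pow_rootMultiplicity_dvd B₁ 1) hB₁0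
    rwa [natDegree_pow, natDegree_X_sub_C, mul_one] at this
  have hmp : m < p :=
    (hmB.trans (natDegree_le_of_dvd (Dvd.intro_left g hB₁.symm) hB)).trans_lt hBp
  have hm0 : (m : F) ≠ 0 := by
    intro h0
    exact absurd (Nat.le_of_dvd hmpos ((CharP.cast_eq_zero_iff F p m).1 h0)) (not_le.2 hmp)
  obtain ⟨k, hk⟩ : ∃ k, m = k + 1 := ⟨m - 1, by omega⟩
  rw [hk] at hD hm0
  have hC1 : (X - C 1 : F[X]) = X - 1 := by simp
  rw [hC1] at hD
  have hX1 : (X - 1 : F[X]) ≠ 0 := by rw [← hC1]; exact X_sub_C_ne_zero 1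
  -- After cancelling `(X - 1) ^ m`, only the term with factor `m = k + 1` survives at `1`.
  have h₂ : -(C a * X) * (derivative A₁ * (X - 1) * D
      - A₁ * (C ((k + 1 : ℕ) : F) * D + (X - 1) * derivative D)) =
      -(C b * (X - 1) * A₁ * D) - C e * γ * ((X - 1) ^ (k + 1) * D ^ 2) := by
    apply mul_left_cancel₀ (pow_ne_zero (k + 1) hX1)
    rw [hD] at h₁
    simp only [derivative_mul, derivative_pow, derivative_sub, derivative_X, derivative_one,
      Nat.add_sub_cancel, sub_zero, mul_one] at h₁
    linear_combination h₁
  have h₃ := congrArg (eval 1) h₂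
  simp [ha, hA1, hD1] at h₃
  exact hm0 (by exact_mod_cast h₃)

/-! ### Degrees of resultants and orders of vanishing -/

theorem natDegree_det_le_of_entry_le {R : Type*} [CommRing R] {n : Type*} [Fintype n]
    [DecidableEq n] (M : Matrix n n R[X]) (D : ℕ) (hM : ∀ i j, (M i j).natDegree ≤ D) :
    M.det.natDegree ≤ Fintype.card n * D := by
  rw [Matrix.det_apply]
  refine natDegree_sum_le_of_forall_le _ _ fun σ _ => ?_
  refine (natDegree_smul_le _ _).trans ?_
  refine (natDegree_prod_le _ _).trans ?_
  calc ∑ i, (M (σ i) i).natDegree ≤ ∑ _i : n, D := Finset.sum_le_sum fun i _ => hM _ _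
    _ = _ := by simp

theorem natDegree_resultant_le {R : Type*} [CommRing R] (f g : R[X][X]) (m n D : ℕ)
    (hf : ∀ i, (f.coeff i).natDegree ≤ D) (hg : ∀ i, (g.coeff i).natDegree ≤ D) :
    (resultant f g m n).natDegree ≤ (m + n) * D := by
  have := natDegree_det_le_of_entry_le (sylvester f g m n) D fun i j => by
    induction j using Fin.addCases <;>
    · simp only [sylvester, Matrix.of_apply, Fin.addCases_left, Fin.addCases_right]
      split_ifs <;> simp [hf, hg]
  simpa [resultant] using this

theorem le_natDegree_of_X_pow_dvd_coe {F : Type*} [Field F] {r : F[X]} (hr : r ≠ 0) {T : ℕ}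
    (h : (PowerSeries.X : PowerSeries F) ^ T ∣ (r : PowerSeries F)) : T ≤ r.natDegree := by
  by_contra! hlt
  have := PowerSeries.X_pow_dvd_iff.1 h _ hlt
  rw [Polynomial.coeff_coe] at this
  exact hr (leadingCoeff_eq_zero.1 this)

/-- The factor `x` in the leading coefficient of the equation makes differentiation cost no order of
vanishing. -/
theorem X_pow_dvd_X_mul_derivative {F : Type*} [Field F] {P : PowerSeries F} {T : ℕ}
    (h : (PowerSeries.X : PowerSeries F) ^ T ∣ P) :
    (PowerSeries.X : PowerSeries F) ^ T ∣ PowerSeries.X * PowerSeries.derivative F P := by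
  rw [PowerSeries.X_pow_dvd_iff] at h ⊢
  intro m hm
  cases m with
  | zero => simp
  | succ m => rw [PowerSeries.coeff_succ_X_mul, PowerSeries.coeff_derivative, h _ hm, zero_mul]

/-! ### The vector field of the differential equation -/

/-- Differentiation of the coefficients of a bivariate polynomial. -/
noncomputable def coeffDerivative (F : Type*) [Field F] : F[X][X] →ₗ[F] F[X][X] :=
  lsum fun n => (monomial n : F[X] →ₗ[F[X]] F[X][X]).restrictScalars F ∘ₗ derivative

theorem coeffDerivative_monomial {F : Type*} [Field F] (n : ℕ) (c : F[X]) :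
    coeffDerivative F (monomial n c) = monomial n (derivative c) := by
  simp [coeffDerivative, lsum_apply, sum_monomial_index]

theorem coeff_coeffDerivative {F : Type*} [Field F] (f : F[X][X]) (i : ℕ) :
    (coeffDerivative F f).coeff i = derivative (f.coeff i) := by
  induction f using Polynomial.induction_on' with
  | add f g hf hg => simp [hf, hg]
  | monomial n c =>
    rw [coeffDerivative_monomial, coeff_monomial, coeff_monomial]
    split_ifs <;> simp

/-- The vector field `q ∂/∂x + (β y + γ) ∂/∂y` applied to a bivariate polynomial. -/
noncomputable def vectorField {F : Type*} [Field F] (q β γ : F[X]) (f : F[X][X]) : F[X][X] :=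
  C q * coeffDerivative F f + derivative f * (C β * X + C γ)

theorem coeff_vectorField {F : Type*} [Field F] (q β γ : F[X]) (f : F[X][X]) (i : ℕ) :
    (vectorField q β γ f).coeff i = q * derivative (f.coeff i) + (i : F[X]) * β * f.coeff i
      + ((i + 1 : ℕ) : F[X]) * γ * f.coeff (i + 1) := by
  have h1 : (derivative f * (C β * X)).coeff i = (i : F[X]) * β * f.coeff i := by
    rw [← mul_assoc, mul_comm (derivative f), mul_assoc, coeff_C_mul]
    cases i with
    | zero => simp
    | succ i => rw [coeff_mul_X, coeff_derivative]; push_cast; ring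
  rw [vectorField, coeff_add, mul_add, coeff_add, h1, coeff_C_mul, coeff_coeffDerivative,
    coeff_mul_C, coeff_derivative]
  push_cast
  ring

/-- Substitution `f ↦ f(x, G(x))` of a power series into a bivariate polynomial. -/
noncomputable def substSeries {F : Type*} [Field F] (G : PowerSeries F) :
    F[X][X] →+* PowerSeries F :=
  eval₂RingHom Polynomial.coeToPowerSeries.ringHom G

theorem substSeries_C {F : Type*} [Field F] (G : PowerSeries F) (c : F[X]) :
    substSeries G (C c) = (c : PowerSeries F) := by
  simp [substSeries]

theorem substSeries_X {F : Type*} [Field F] (G : PowerSeries F) :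
    substSeries G X = G := by
  simp [substSeries]

/-- The chain rule; the correction is a multiple of the defect of `G` in the equation. -/
theorem substSeries_vectorField {F : Type*} [Field F] (G : PowerSeries F) (q β γ : F[X])
    (f : F[X][X]) :
    substSeries G (vectorField q β γ f) =
      q * PowerSeries.derivative F (substSeries G f) -
        substSeries G (derivative f) * (q * PowerSeries.derivative F G - (β * G + γ)) := by
  have key : substSeries G (coeffDerivative F f) =
      PowerSeries.derivative F (substSeries G f) -
        substSeries G (derivative f) * PowerSeries.derivative F G := by
    induction f using Polynomial.induction_on' with
    | add f g hf hg => simp only [map_add, hf, hg]; ring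
    | monomial n c =>
      rw [coeffDerivative_monomial, derivative_monomial]
      simp only [← C_mul_X_pow_eq_monomial, map_mul, map_pow, substSeries_C, substSeries_X,
        Derivation.leibniz, Derivation.leibniz_pow, smul_eq_mul, PowerSeries.derivative_coe,
        map_natCast, nsmul_eq_mul]
      ring
  rw [vectorField, map_add, map_mul, key, map_mul, map_add, map_mul, substSeries_C,
    substSeries_C, substSeries_C, substSeries_X]
  ring

/-- An irreducible `f` whose resultant with `g` vanishes divides `g` up to a scalar. -/
theorem coeff_mul_comm_of_resultant_eq_zero {F : Type*} [Field F] {f g : F[X][X]}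
    (hf : Irreducible f) (hf0 : f.natDegree ≠ 0) (hg : g.natDegree ≤ f.natDegree)
    (hres : resultant f g = 0) (i j : ℕ) (hj : j = f.natDegree) :
    g.coeff j * f.coeff i = f.coeff j * g.coeff i := by
  subst hj
  let K := FractionRing F[X]
  have hinj : Function.Injective (algebraMap F[X] K) := IsFractionRing.injective F[X] K
  -- Gauss's lemma: irreducibility passes to `F(x)[y]`, where a common factor with `g` must be `f`
  -- itself.
  have hirr : Irreducible (f.map (algebraMap F[X] K)) :=
    (hf.isPrimitive hf0).irreducible_iff_irreducible_map_fraction_map.1 hf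
  have hres' : resultant (f.map (algebraMap F[X] K)) (g.map (algebraMap F[X] K)) = 0 := by
    rw [natDegree_map_eq_of_injective hinj, natDegree_map_eq_of_injective hinj,
      resultant_map_map, hres, map_zero]
  have hdvd : f.map (algebraMap F[X] K) ∣ g.map (algebraMap F[X] K) := by
    by_contra hnd
    exact (resultant_eq_zero_iff.1 hres').2 (hirr.coprime_iff_not_dvd.2 hnd)
  obtain ⟨c, hc⟩ := hdvd
  have hcdeg : c.natDegree = 0 := by
    by_cases hc0 : c = 0
    · simp [hc0]
    have := congrArg natDegree hc
    rw [natDegree_mul hirr.ne_zero hc0, natDegree_map_eq_of_injective hinj,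
      natDegree_map_eq_of_injective hinj] at this
    omega
  obtain ⟨r, hr⟩ := natDegree_eq_zero.1 hcdeg
  have hcoeff : ∀ i, algebraMap F[X] K (g.coeff i) = algebraMap F[X] K (f.coeff i) * r := by
    intro i
    have := congrArg (fun t => coeff t i) hc
    simpa [← hr] using this
  apply hinj
  rw [map_mul, map_mul, hcoeff, hcoeff]
  ring

theorem natDegree_vectorField_le {F : Type*} [Field F] (q β γ : F[X]) (f : F[X][X]) :
    (vectorField q β γ f).natDegree ≤ f.natDegree := by
  rw [natDegree_le_iff_coeff_eq_zero]
  intro i hi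
  rw [coeff_vectorField, coeff_eq_zero_of_natDegree_lt hi,
    coeff_eq_zero_of_natDegree_lt (hi.trans (Nat.lt_succ_self i))]
  simp

theorem natDegree_coeff_vectorField_le {F : Type*} [Field F] {q β γ : F[X]} {f : F[X][X]}
    {k D : ℕ} (hq : q.natDegree ≤ 2) (hβ : β.natDegree ≤ 1) (hγ : γ.natDegree ≤ D + 1)
    (hf : ∀ i, (f.coeff i).natDegree ≤ k) (i : ℕ) :
    ((vectorField q β γ f).coeff i).natDegree ≤ k + D + 1 := by
  rw [coeff_vectorField]
  refine natDegree_add_le_of_degree_le (natDegree_add_le_of_degree_le ?_ ?_) ?_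
  · by_cases h0 : (f.coeff i).natDegree = 0
    · rw [derivative_of_natDegree_zero h0]; simp
    · have h1 := natDegree_derivative_lt h0
      have h2 := hf i
      refine natDegree_mul_le.trans ?_
      omega
  · refine natDegree_mul_le.trans ?_
    have h1 := natDegree_mul_le (p := (i : F[X])) (q := β)
    rw [natDegree_natCast] at h1
    have h2 := hf i
    omega
  · refine natDegree_mul_le.trans ?_
    have h1 := natDegree_mul_le (p := ((i + 1 : ℕ) : F[X])) (q := γ)
    rw [natDegree_natCast] at h1
    have h2 := hf (i + 1)
    omega

/-- The order of vanishing of `f(x, G(x))` for an irreducible polynomial `f`, when `G` solves a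
linear differential equation modulo `x ^ L`. -/
theorem order_substSeries_le_of_irreducible {F : Type*} [Field F] (p : ℕ) [CharP F p]
    {a b : F} (ha : a ≠ 0) {γ : F[X]} (hγ : γ.eval 1 ≠ 0) {D : ℕ} (hγD : γ.natDegree ≤ D + 1)
    {G : PowerSeries F} {L : ℕ}
    (hG : (PowerSeries.X : PowerSeries F) ^ L ∣
      ((C a * X * (1 - X) : F[X]) : PowerSeries F) * PowerSeries.derivative F G -
        (((C b * (1 - X) : F[X]) : PowerSeries F) * G + (γ : PowerSeries F)))
    {f : F[X][X]} (hf : Irreducible f) {k : ℕ} (hk0 : 0 < k) (hfk : f.natDegree ≤ k)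
    (hfc : ∀ i, (f.coeff i).natDegree ≤ k) (hkp : k < p) {T : ℕ} (hTL : T ≤ L)
    (hT : (PowerSeries.X : PowerSeries F) ^ T ∣ substSeries G f) :
    T ≤ 2 * k * (k + D + 1) := by
  by_cases hf0 : f.natDegree = 0
  · obtain ⟨c, rfl⟩ := natDegree_eq_zero.1 hf0
    have hc : c ≠ 0 := by rintro rfl; exact hf.ne_zero C_0
    rw [substSeries_C] at hT
    have h1 := le_natDegree_of_X_pow_dvd_coe hc hT
    have h2 := hfc 0
    rw [coeff_C_zero] at h2
    nlinarith
  set g := vectorField (C a * X * (1 - X)) (C b * (1 - X)) γ f with hg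
  have hgdeg : g.natDegree ≤ f.natDegree := natDegree_vectorField_le ..
  have hlin : (1 - X : F[X]).natDegree ≤ 1 := by compute_degree
  have hgc : ∀ i, (g.coeff i).natDegree ≤ k + D + 1 :=
    natDegree_coeff_vectorField_le (by compute_degree) (by compute_degree) hγD hfc
  have hgT : (PowerSeries.X : PowerSeries F) ^ T ∣ substSeries G g := by
    rw [hg, substSeries_vectorField]
    refine dvd_sub ?_ (Dvd.dvd.mul_left ((pow_dvd_pow _ hTL).trans hG) _)
    have : ((C a * X * (1 - X) : F[X]) : PowerSeries F)
        * PowerSeries.derivative F (substSeries G f) =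
        ((C a * (1 - X) : F[X]) : PowerSeries F)
          * (PowerSeries.X * PowerSeries.derivative F (substSeries G f)) := by
      rw [← mul_assoc, ← Polynomial.coe_X, ← Polynomial.coe_mul]
      congr 2
      ring
    rw [this]
    exact Dvd.dvd.mul_left (X_pow_dvd_X_mul_derivative hT) _
  by_cases hres : resultant f g = 0
  · exfalso
    obtain ⟨e, he⟩ : ∃ e, f.natDegree = e + 1 := ⟨f.natDegree - 1, by omega⟩
    -- The ratio of the coefficients of `y ^ e` and `y ^ (e + 1)` in `f` is the forbidden rational
    -- solution.
    have h := coeff_mul_comm_of_resultant_eq_zero hf hf0 hgdeg hres e (e + 1) he.symm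
    have hlc : f.coeff (e + 1) ≠ 0 := by
      rw [← he]; exact leadingCoeff_ne_zero.2 hf.ne_zero
    have he0 : ((e + 1 : ℕ) : F) ≠ 0 := by
      intro h0
      have := Nat.le_of_dvd e.succ_pos ((CharP.cast_eq_zero_iff F p _).1 h0)
      omega
    refine rational_ode_unsolvable p (b := b) ha he0 (A := f.coeff e) hγ hlc
      ((hfc _).trans_lt hkp) ?_
    rw [hg, coeff_vectorField, coeff_vectorField,
      coeff_eq_zero_of_natDegree_lt (show f.natDegree < e + 1 + 1 by omega)] at h
    rw [show C ((e + 1 : ℕ) : F) = ((e + 1 : ℕ) : F[X]) by simp]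
    push_cast at h ⊢
    linear_combination -h
  · obtain ⟨u, v, -, -, huv⟩ := exists_mul_add_mul_eq_C_resultant f g le_rfl le_rfl (Or.inl hf0)
    have hdvd : (PowerSeries.X : PowerSeries F) ^ T ∣
        ((resultant f g : F[X]) : PowerSeries F) := by
      rw [← substSeries_C G, ← huv, map_add, map_mul, map_mul]
      exact dvd_add (hT.mul_right _) (hgT.mul_right _)
    refine (le_natDegree_of_X_pow_dvd_coe hres hdvd).trans ?_
    refine (natDegree_resultant_le f g _ _ (k + D + 1)
      (fun i => (hfc i).trans (by omega)) hgc).trans ?_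
    exact Nat.mul_le_mul_right _ (by omega)

/-! ### From irreducible to arbitrary bivariate polynomials -/

/-- Bivariate polynomials in `x = X 0` and `y = X 1` as polynomials in `y` over `F[x]`. -/
noncomputable def bivariateEquiv (F : Type*) [Field F] : MvPolynomial (Fin 2) F ≃ₐ[F] F[X][X] :=
  (Polynomial.Bivariate.equivMvPolynomial F).symm

theorem bivariateEquiv_apply {F : Type*} [Field F] (h : MvPolynomial (Fin 2) F) :
    bivariateEquiv F h = MvPolynomial.aeval ![(C X : F[X][X]), X] h := rfl

theorem substSeries_bivariateEquiv {F : Type*} [Field F] (G : PowerSeries F)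
    (h : MvPolynomial (Fin 2) F) :
    substSeries G (bivariateEquiv F h) = MvPolynomial.aeval ![PowerSeries.X, G] h := by
  rw [bivariateEquiv_apply]
  induction h using MvPolynomial.induction_on with
  | C c =>
    rw [MvPolynomial.algHom_C, MvPolynomial.algHom_C]
    rw [Polynomial.algebraMap_apply, substSeries_C]
    simp
  | add f g hf hg => simp only [map_add, hf, hg]
  | mul_X f i hf =>
    rw [map_mul, map_mul, map_mul, hf]
    fin_cases i <;> simp [substSeries_C, substSeries_X]

theorem bivariateEquiv_degree_le {F : Type*} [Field F] (h : MvPolynomial (Fin 2) F) :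
    (bivariateEquiv F h).natDegree ≤ h.totalDegree ∧
      ∀ i, ((bivariateEquiv F h).coeff i).natDegree ≤ h.totalDegree := by
  have hterm : ∀ m ∈ h.support, m 0 + m 1 ≤ h.totalDegree := fun m hm => by
    have := MvPolynomial.le_totalDegree hm
    rwa [Finsupp.sum_fintype _ _ (fun _ => rfl), Fin.sum_univ_two] at this
  have hsum : bivariateEquiv F h =
      ∑ m ∈ h.support, monomial (m 1) (C (h.coeff m) * X ^ (m 0)) := by
    rw [bivariateEquiv_apply, MvPolynomial.aeval_def, MvPolynomial.eval₂_eq']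
    refine Finset.sum_congr rfl fun m _ => ?_
    rw [Fin.prod_univ_two, ← C_mul_X_pow_eq_monomial, Polynomial.algebraMap_apply]
    simp [mul_assoc]
  rw [hsum]
  constructor
  · refine natDegree_sum_le_of_forall_le _ _ fun m hm => (natDegree_monomial_le _).trans ?_
    have := hterm m hm
    omega
  · intro i
    rw [finsetSum_coeff]
    refine natDegree_sum_le_of_forall_le _ _ fun m hm => ?_
    rw [coeff_monomial]
    split_ifs
    · refine (natDegree_C_mul_X_pow_le _ _).trans ?_
      have := hterm m hm
      omega
    · simp

theorem order_aeval_le_of_forall_irreducible {F : Type*} [Field F] (G : PowerSeries F) (B d : ℕ)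
    (hirr : ∀ k : MvPolynomial (Fin 2) F, Irreducible k → k.totalDegree ≤ d →
      (MvPolynomial.aeval ![PowerSeries.X, G] k).order ≤ (B * k.totalDegree : ℕ))
    (h : MvPolynomial (Fin 2) F) (h0 : h ≠ 0) (hd : h.totalDegree ≤ d) :
    (MvPolynomial.aeval ![PowerSeries.X, G] h).order ≤ (B * h.totalDegree : ℕ) := by
  induction h using WfDvdMonoid.induction_on_irreducible with
  | zero => exact absurd rfl h0
  | unit u hu =>
    have := (hu.map (MvPolynomial.aeval (R := F) ![PowerSeries.X, G]))
    rw [PowerSeries.order_zero_of_unit this]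
    exact zero_le
  | mul f k hf hk ih =>
    have hdeg := MvPolynomial.totalDegree_mul_of_isDomain hk.ne_zero hf
    rw [map_mul, PowerSeries.order_mul, hdeg, mul_add, Nat.cast_add]
    exact add_le_add (hirr k hk (by omega)) (ih hf (by omega))

/-- A nonzero polynomial of degree `d` cannot annihilate `G` modulo a large power of `x`. -/
theorem le_of_X_pow_dvd_aeval {F : Type*} [Field F] (p : ℕ) [CharP F p]
    {a b : F} (ha : a ≠ 0) {γ : F[X]} (hγ : γ.eval 1 ≠ 0) {D : ℕ} (hγD : γ.natDegree ≤ D + 1)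
    {G : PowerSeries F} {L : ℕ}
    (hG : (PowerSeries.X : PowerSeries F) ^ L ∣
      ((C a * X * (1 - X) : F[X]) : PowerSeries F) * PowerSeries.derivative F G -
        (((C b * (1 - X) : F[X]) : PowerSeries F) * G + (γ : PowerSeries F)))
    {h : MvPolynomial (Fin 2) F} (h0 : h ≠ 0) {d : ℕ} (hd : h.totalDegree ≤ d) (hdp : d < p)
    (hL : (PowerSeries.X : PowerSeries F) ^ L ∣ MvPolynomial.aeval ![PowerSeries.X, G] h) :
    L ≤ 2 * d * (d + D + 1) := by
  by_contra! hlt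
  have key := order_aeval_le_of_forall_irreducible G (2 * (d + D + 1)) d (fun k hk hkd => by
    have hk0 : 0 < k.totalDegree := by
      rw [Nat.pos_iff_ne_zero]
      intro hz
      rw [MvPolynomial.totalDegree_eq_zero_iff_eq_C] at hz
      refine hk.not_isUnit ?_
      rw [hz]
      refine IsUnit.map _ (isUnit_iff_ne_zero.2 fun hc => hk.ne_zero ?_)
      rw [hz, hc, map_zero]
    by_contra! hbig
    -- The equation is known only modulo `x ^ L`, so the order is truncated at `L`; both arguments
    -- of the `min` exceed the bound for irreducibles.
    have hT : (PowerSeries.X : PowerSeries F) ^ min (2 * (d + D + 1) * k.totalDegree + 1) L ∣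
        substSeries G (bivariateEquiv F k) := by
      rw [substSeries_bivariateEquiv]
      refine (pow_dvd_pow _ (min_le_left _ _)).trans ?_
      rw [PowerSeries.X_pow_dvd_iff]
      intro m hm
      apply PowerSeries.coeff_of_lt_order
      refine lt_of_le_of_lt ?_ hbig
      exact_mod_cast Nat.lt_succ_iff.1 hm
    have hdeg := bivariateEquiv_degree_le k
    have hle := order_substSeries_le_of_irreducible p ha hγ hγD hG
      ((MulEquiv.irreducible_iff (bivariateEquiv F)).2 hk) hk0 hdeg.1 hdeg.2 (by omega)
      (min_le_right _ _) hT
    have h1 : 2 * k.totalDegree * (k.totalDegree + D + 1) ≤ 2 * (d + D + 1) * k.totalDegree := by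
      nlinarith
    have h2 : 2 * (d + D + 1) * k.totalDegree ≤ 2 * d * (d + D + 1) := by nlinarith
    omega) h h0 hd
  have h3 : ((L : ℕ) : ℕ∞) ≤ (MvPolynomial.aeval ![PowerSeries.X, G] h).order :=
    PowerSeries.le_order _ _ fun i hi => PowerSeries.X_pow_dvd_iff.1 hL i (by exact_mod_cast hi)
  have h4 : L ≤ 2 * (d + D + 1) * h.totalDegree := by exact_mod_cast h3.trans key
  have h5 : 2 * (d + D + 1) * h.totalDegree ≤ 2 * d * (d + D + 1) := by nlinarith
  omega

/-! ### The explicit inversive generator -/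

theorem coeff_explicitInversive_ode (p : ℕ) [Fact p.Prime] (a b : ZMod p) (n : ℕ) :
    PowerSeries.coeff n (PowerSeries.C a * (PowerSeries.X *
      PowerSeries.derivative (ZMod p) (genFun (explicitInversive p a b))) -
        PowerSeries.C b * genFun (explicitInversive p a b)) =
      if a * (n : ZMod p) - b = 0 then 0 else 1 := by
  have h : PowerSeries.coeff n (PowerSeries.C a * (PowerSeries.X *
      PowerSeries.derivative (ZMod p) (genFun (explicitInversive p a b))) -
        PowerSeries.C b * genFun (explicitInversive p a b)) =
      (a * (n : ZMod p) - b) * explicitInversive p a b n := by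
    rw [map_sub, PowerSeries.coeff_C_mul, PowerSeries.coeff_C_mul]
    cases n with
    | zero => simp [genFun]
    | succ n =>
      rw [PowerSeries.coeff_succ_X_mul, PowerSeries.coeff_derivative, genFun,
        PowerSeries.coeff_mk]
      push_cast
      ring
  rw [h, explicitInversive]
  split_ifs with h0
  · simp
  · exact mul_inv_cancel₀ h0

theorem explicitInversive_ode (p : ℕ) [Fact p.Prime] (a b : ZMod p) {L : ℕ} {γ : (ZMod p)[X]}
    {S : PowerSeries (ZMod p)} (hS : (1 - PowerSeries.X) * S = (γ : PowerSeries (ZMod p)))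
    (hcoeff : ∀ n < L, PowerSeries.coeff n S = if a * (n : ZMod p) - b = 0 then 0 else 1) :
    (PowerSeries.X : PowerSeries (ZMod p)) ^ L ∣
      ((C a * X * (1 - X) : (ZMod p)[X]) : PowerSeries (ZMod p)) *
        PowerSeries.derivative (ZMod p) (genFun (explicitInversive p a b)) -
        (((C b * (1 - X) : (ZMod p)[X]) : PowerSeries (ZMod p)) *
          genFun (explicitInversive p a b) + (γ : PowerSeries (ZMod p))) := by
  have hdvd : (PowerSeries.X : PowerSeries (ZMod p)) ^ L ∣
      PowerSeries.C a * (PowerSeries.X *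
        PowerSeries.derivative (ZMod p) (genFun (explicitInversive p a b))) -
          PowerSeries.C b * genFun (explicitInversive p a b) - S := by
    rw [PowerSeries.X_pow_dvd_iff]
    intro n hn
    rw [map_sub, coeff_explicitInversive_ode, hcoeff n hn, sub_self]
  convert hdvd.mul_left (1 - PowerSeries.X) using 1
  rw [← hS]
  simp only [Polynomial.coe_mul, Polynomial.coe_sub, Polynomial.coe_C, Polynomial.coe_X,
    Polynomial.coe_one]
  ring

/-- If a nonzero polynomial of degree at most `d < p` annihilates the generating function of the
explicit inversive generator modulo `x ^ N`, then `N` is at most cubic in `d`. -/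
theorem le_of_annihilatesMod_explicitInversive (p : ℕ) [Fact p.Prime] {a b : ZMod p}
    (ha : a ≠ 0) {N d : ℕ} (hN : N < p) (hdp : d < p) {h : MvPolynomial (Fin 2) (ZMod p)}
    (h0 : h ≠ 0) (hd : h.totalDegree ≤ d)
    (hann : AnnihilatesMod (explicitInversive p a b) N h) :
    N ≤ 2 * d * (2 * d ^ 2 + 3 * d + 1) := by
  obtain ⟨n₀, hn₀, hn₀p⟩ : ∃ n₀ : ℕ, (∀ n < p, a * (n : ZMod p) - b = 0 ↔ n = n₀) ∧ n₀ < p := by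
    refine ⟨(b / a).val, fun n hn => ?_, ZMod.val_lt _⟩
    rw [sub_eq_zero, mul_comm, ← eq_div_iff ha]
    constructor
    · intro h; rw [← h, ZMod.val_cast_of_lt hn]
    · rintro rfl; exact ZMod.natCast_zmod_val _
  have hgeom : (1 - PowerSeries.X) * PowerSeries.mk (1 : ℕ → ZMod p) = 1 := by
    rw [mul_comm]; exact PowerSeries.mk_one_mul_one_sub_eq_one _
  -- Below `n₀` the right-hand side is the geometric series, so `γ = 1`.
  have hmin : min n₀ N ≤ 2 * d * (d + 0 + 1) := by
    refine le_of_X_pow_dvd_aeval p (b := b) (γ := 1) (D := 0) ha (by simp) (by simp)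
      (explicitInversive_ode p a b (S := PowerSeries.mk 1) (by simpa using hgeom) ?_) h0 hd hdp
      ((pow_dvd_pow _ (min_le_right _ _)).trans hann)
    intro n hn
    rw [if_neg (by rw [hn₀ n (by omega)]; omega)]
    simp
  -- Removing the term `x ^ n₀` from the geometric series makes the equation valid up to `N`.
  have hfull : N ≤ 2 * d * (d + n₀ + 1) := by
    refine le_of_X_pow_dvd_aeval p (b := b) (γ := 1 - X ^ n₀ * (1 - X)) ha (by simp)
      (by compute_degree) (explicitInversive_ode p a b (S := PowerSeries.mk 1 - PowerSeries.X ^ n₀)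
        ?_ ?_) h0 hd hdp hann
    · rw [mul_sub, hgeom]
      simp only [Polynomial.coe_mul, Polynomial.coe_sub, Polynomial.coe_pow, Polynomial.coe_X,
        Polynomial.coe_one]
      ring
    · intro n hn
      simp only [hn₀ n (by omega), map_sub, PowerSeries.coeff_mk, PowerSeries.coeff_X_pow]
      split_ifs <;> simp
  rcases le_total N n₀ with hle | hle
  · rw [min_eq_right hle] at hmin
    exact hmin.trans (Nat.mul_le_mul_left _ (by nlinarith))
  · rw [min_eq_left hle] at hmin
    refine hfull.trans (Nat.mul_le_mul_left _ ?_)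
    nlinarith

theorem not_forall_explicitInversive_eq_zero (p : ℕ) [Fact p.Prime] {a b : ZMod p}
    (ha : a ≠ 0) {N : ℕ} (hN2 : 2 ≤ N) :
    ¬ ∀ n < N, explicitInversive p a b n = 0 := by
  intro h
  have hz : ∀ n < N, a * (n : ZMod p) - b = 0 := by
    intro n hn
    have h1 := h n hn
    rw [explicitInversive] at h1
    split_ifs at h1 with h2
    · exact h2
    · exact inv_eq_zero.1 h1
  have h1 := hz 0 (by omega)
  have h2 := hz 1 (by omega)
  apply ha
  push_cast at h1 h2
  linear_combination h2 - h1

theorem totalDegree_pos_of_annihilatesMod {F : Type*} [Field F] {s : ℕ → F} {N : ℕ} (hN : 0 < N)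
    {h : MvPolynomial (Fin 2) F} (h0 : h ≠ 0) (hann : AnnihilatesMod s N h) :
    0 < h.totalDegree := by
  rw [Nat.pos_iff_ne_zero]
  intro hz
  rw [MvPolynomial.totalDegree_eq_zero_iff_eq_C] at hz
  have hc : h.coeff 0 = 0 := by
    have h1 : PowerSeries.X ^ N ∣
        MvPolynomial.aeval ![PowerSeries.X, genFun s] (MvPolynomial.C (h.coeff 0)) := hz ▸ hann
    rw [MvPolynomial.algHom_C, PowerSeries.X_pow_dvd_iff] at h1
    simpa using h1 0 hN
  apply h0
  rw [hz, hc, map_zero]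

theorem corollary4p3 :
    ∃ c : ℝ, 0 < c ∧
      ∀ (p : ℕ) [Fact p.Prime] (a b : ZMod p), a ≠ 0 →
        ∀ N : ℕ, 2 ≤ N → N < p →
          c * (N : ℝ) ^ (1 / 4 : ℝ) ≤
            (expansionComplexity (explicitInversive p a b) N : ℝ) := by
  refine ⟨1 / 2, by norm_num, ?_⟩
  intro p _ a b ha N hN2 hNp
  rw [expansionComplexity, if_neg (not_forall_explicitInversive_eq_zero p ha hN2)]
  obtain ⟨h, h0, hann, hdeg⟩ :=
    Nat.sInf_mem (expansionComplexity_set_nonempty (explicitInversive p a b) N)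
  rw [← hdeg]
  set d := h.totalDegree
  have hd1 : 1 ≤ d := totalDegree_pos_of_annihilatesMod (by omega) h0 hann
  -- The cubic bound needs `d < p`; otherwise `N < p ≤ d` suffices.
  have hbound : N ≤ (2 * d) ^ 4 := by
    rcases lt_or_ge d p with hdp | hdp
    · refine (le_of_annihilatesMod_explicitInversive p ha hNp hdp h0 le_rfl hann).trans ?_
      have h1 : d ≤ d ^ 4 := Nat.le_self_pow (by norm_num) d
      have h2 : d ^ 2 ≤ d ^ 4 := Nat.pow_le_pow_right hd1 (by norm_num)
      have h3 : d ^ 3 ≤ d ^ 4 := Nat.pow_le_pow_right hd1 (by norm_num)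
      nlinarith
    · exact (hNp.le.trans hdp).trans
        ((Nat.le_mul_of_pos_left d two_pos).trans (Nat.le_self_pow (by norm_num) _))
  have hbound' : (N : ℝ) ≤ (2 * (d : ℝ)) ^ 4 := by exact_mod_cast hbound
  have hroot : (N : ℝ) ^ (1 / 4 : ℝ) ≤ 2 * (d : ℝ) := by
    calc (N : ℝ) ^ (1 / 4 : ℝ) ≤ ((2 * (d : ℝ)) ^ 4) ^ (1 / 4 : ℝ) :=
          Real.rpow_le_rpow (Nat.cast_nonneg _) hbound' (by norm_num)
      _ = 2 * (d : ℝ) := by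
          rw [← Real.rpow_natCast, ← Real.rpow_mul (by positivity)]
          norm_num
  linarith
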